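/- **Validity of clock irrelevance for the clock intersection type of Guarded Computational Type Theory.** *Worlds.* A world is $\mathbf U=(U,\partial_U)$ with $U$ a nonempty finite set of clock names and $\partial_U:U\to\mathbb N$ (the time left on each clock). A morphism $\rho:\mathbf V\to\mathbf U$ is a function $\rho^*:U\to V$ with $\partial_V(\rho^*\kappa)\le\partial_U(\kappa)$ for all $\kappa\in U$. Let $\mathcal S$ be the topos of presheaves of sets on this category, $\mathrm{Clk}\in\mathcal S$ the object $\mathrm{Clk}(\mathbf U)=U$ of clock names, and write $\mathbf U\Vdash\varphi$ for Kripke–Joyal forcing. For $\kappa:\mathrm{Clk}$ the modality $\triangleright_\kappa$ on propositions is defined by: $\mathbf U\Vdash\triangleright_\kappa\varphi$ iff either $\partial_U(\kappa)=0$, or $\partial_U(\kappa)=m+1$ and $\mathbf U[\kappa\mapsto m]\Vdash\varphi$ (restricted along the identity on names). The definitions of the next three paragraphs are made in the internal language of $\mathcal S$. *Programs.* $\mathrm{Tm}_n$ (programs with $n$ free variables) is inductively generated by variables; $\lambda x.M$, $M\,N$; $\langle M,N\rangle$, $\mathtt{fst}\,M$, $\mathtt{snd}\,M$; $\mathtt{fix}\,x.M$;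 $\star$, $\mathtt{tt}$, $\mathtt{ff}$, $\mathtt{if}$; $\mathtt{ze}$, $\mathtt{su}\,M$, $\mathtt{ifze}$; $\mathtt{sup}(M;x.N)$, $\mathtt{wrec}$; the types $(x{:}A)\to B$, $(x{:}A)\times B$, $(\mathsf W x{:}A)B$, $\mathsf{Eq}_A(M,N)$, $\mathtt{void}$, $\mathtt{unit}$, $\mathtt{bool}$, $\mathtt{nat}$, $\mathcal U_i$ ($i\in\mathbb N$); clock application $M\,\kappa$ and the later type $\triangleright_\kappa A$ for $\kappa:\mathrm{Clk}$; and clock abstraction $\lambda M$, clock product $\prod A$, clock intersection $\bigcap A$ for $M,A\in\mathrm{Tm}_n^{\mathrm{Clk}}$. Closed programs have the standard call-by-name (weak head, deterministic) small-step semantics $\mapsto$; values are the programs headed by an introduction form or a type former (with lazy components). $M\Downarrow v$ means $M\mapsto^*v$ and $v$ is a value. For a relation $R$ on $\mathrm{Tm}_0$ put $R^{\Downarrow}=\{(M_0,M_1)\mid\exists v_0,v_1.\ M_i\Downarrow v_i,\ (v_0,v_1)\in R\}$, and for a relation $\tau$ between closed programs and relations put $\tau^\Downarrow=\{(A,R)\mid\exists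 v.\ A\Downarrow v,\ (v,R)\in\tau\}$. *Type systems.* A candidate type system is a relation $\tau\subseteq\mathrm{Tm}_0\times\mathcal P(\mathrm{Tm}_0\times\mathrm{Tm}_0)$. Let $\mathrm{Conns}(\tau)$ consist of the following pairs. - $(\mathtt{void},\emptyset)$, $(\mathtt{unit},\{(\star,\star)\}^\Downarrow)$, $(\mathtt{bool},\{(\mathtt{tt},\mathtt{tt}),(\mathtt{ff},\mathtt{ff})\}^\Downarrow)$, and $(\mathtt{nat},(\mu Y.\ \{(\mathtt{ze},\mathtt{ze})\}\cup\{(\mathtt{su}\,M_0,\mathtt{su}\,M_1)\mid(M_0,M_1)\in Y^\Downarrow\})^\Downarrow)$. - For $(A,R)\in\tau$ and a family $S$ of relations indexed by $\mathrm{Tm}_0$ such that $(B[M_j],S(M_k))\in\tau$ for all $(M_0,M_1)\in R$ and $j,k\in\{0,1\}$: the dependent function type $(x{:}A)\to B$ with $\{(M_0,M_1)\mid\forall(N_0,N_1)\in R.\ (M_0N_0,M_1N_1)\in S(N_0)\}$; the dependent pair type $(x{:}A)\times B$ with $\{(M_0,M_1)\mid(\mathtt{fst}\,M_0,\mathtt{fst}\,M_1)\in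 R,\ (\mathtt{snd}\,M_0,\mathtt{snd}\,M_1)\in S(\mathtt{fst}\,M_0)\}$; and $(\mathsf Wx{:}A)B$ with $X^\Downarrow$, where $X=\mu Y.\{(\mathtt{sup}(M_0;x.N_0),\mathtt{sup}(M_1;x.N_1))\mid(M_0,M_1)\in R,\ \forall(O_0,O_1)\in S(M_0).\ (N_0[O_0],N_1[O_1])\in Y^\Downarrow\}$. - For $(A,R)\in\tau$ with $(M_0,M_0),(M_1,M_1)\in R$: $(\mathsf{Eq}_A(M_0,M_1),\{(\star,\star)\mid(M_0,M_1)\in R\}^\Downarrow)$. - For $\kappa:\mathrm{Clk}$ and $R$ with $\triangleright_\kappa((A,R)\in\tau)$: $(\triangleright_\kappa A,\{(M_0,M_1)\mid\triangleright_\kappa((M_0,M_1)\in R)\})$. - For a family $R$ of relations indexed by $\mathrm{Clk}$ with $\forall\kappa.\ (A(\kappa),R(\kappa))\in\tau$: $(\bigcap A,\{(M_0,M_1)\mid\forall\kappa.\ (M_0,M_1)\in R(\kappa)\})$ and $(\prod A,\{(M_0,M_1)\mid\forall\kappa.\ (M_0\,\kappa,M_1\,\kappa)\in R(\kappa)\})$.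 For a candidate $\nu$ let $\mathrm{Cl}(\nu)$ be the least fixed point of $\tau\mapsto\nu\cup\mathrm{Conns}(\tau)^\Downarrow$. Write $\tau\models A\sim B$ if some $R$ satisfies $(A,R),(B,R)\in\tau$, and $\tau\models M\sim N\in A$ if some $R$ satisfies $(A,R)\in\tau$, $(M,N)\in R$. Let $\nu_0=\emptyset$, $\nu_{m+1}=\{(\mathcal U_i,\{(A,B)\mid\mathrm{Cl}(\nu_i)\models A\sim B\})\mid i\le m\}^\Downarrow$, and $\tau_\omega=\bigcup_m\mathrm{Cl}(\nu_m)$. The universes $\mathcal U_i$ carry no index other than $i$; in particular they are not indexed by clock contexts. *Judgments.* For a telescope $\Gamma$, similarity $\gamma_0\sim\gamma_1\in\Gamma$ of closed instantiations is defined by recursion: the last entries of $\gamma_0,\gamma_1$ must be similar in the last type of $\Gamma$ instantiated by the preceding part of $\gamma_0$. $\Gamma\gg A_0\sim A_1$ means $A_0[\gamma_0]\sim A_1[\gamma_1]$ for all $\gamma_0\sim\gamma_1\in\Gamma$; $\Gamma\gg M_0\sim M_1\in A$ means $M_0[\gamma_0]\sim M_1[\gamma_1]\in A[\gamma_0]$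 for all such; $\Gamma$ is a context if each entry $A$ satisfies $\Gamma'\gg A\sim A$ over the preceding entries $\Gamma'$. All this is relative to $\tau_\omega$. Formal terms are finite syntax (up to renaming of bound clocks and variables) with the same operators, except that clocks are formal clock variables, which may be bound, as in $\lambda k.M$, $\prod k.A$, $\bigcap k.A$. A formal term $M$ with free clocks in a finite list $\Delta$ and free variables in a list of length $n$ elaborates, compositionally, to a map $[\![M]\!]:\mathrm{Clk}^{\Delta}\to\mathrm{Tm}_n$, with $[\![\bigcap k.A]\!]\varrho=\bigcap(\kappa\mapsto[\![A]\!](\varrho,\kappa))$; contexts elaborate entrywise. The judgment $\Delta\mid\Gamma\vdash M_0=M_1\in A$ (where $\Gamma,M_0,M_1,A$ mention only clocks from $\Delta$ and variables declared to their left) denotes the proposition of $\mathcal S$ $$\forall\varrho\in\mathrm{Clk}^{\Delta}.\ \big([\![\Gamma]\!]\varrho\text{ is a context}\big)\Rightarrow\big([\![\Gamma]\!]\varrho\gg[\![A]\!]\varrho\sim[\![A]\!]\varrho\big)\Rightarrow\big([\![\Gamma]\!]\varrho\gg[\![M_0]\!]\varrho\sim[\![M_1]\!]\varrho\in[\![A]\!]\varrho\big),$$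 and $\Delta\mid\Gamma\vdash M\in A$ abbreviates $\Delta\mid\Gamma\vdash M=M\in A$. **Theorem (clock irrelevance).** For every clock context $\Delta$ (possibly empty), every $\Gamma$ and $A$ over $\Delta$, every $i\in\mathbb N$ and every clock $k\notin\Delta$, the rule $$\frac{\Delta\mid\Gamma\vdash A\in\mathcal U_i}{\Delta\mid\Gamma\vdash A=\textstyle\bigcap k.A\in\mathcal U_i}$$ is valid in $\mathcal S$: every world $\mathbf U$ that forces the premise forces the conclusion. In particular, if the premise is true in $\mathcal S$, so is the conclusion. -/

import Mathlib

open CategoryTheory Opposite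

namespace ClockCTT

/-! ## The category of clock worlds and its topos of presheaves -/

/-- A world `(U, ∂)`: a nonempty finite set of clock names `U = {0, …, size - 1}`, together with
the time `∂ κ` left on each clock. -/
structure World where
  size : ℕ
  pos : 0 < size
  time : Fin size → ℕ

/-- A morphism of worlds `V ⟶ U` is a vector of projections of clock names, i.e. a function from
the names of `U` to the names of `V`, that does not increase the time left. -/
structure World.Hom (V U : World) where
  map : Fin U.size → Fin V.size
  le : ∀ κ, V.time (map κ) ≤ U.time κ

instance : Category World where
  Hom := World.Hom
  id U := ⟨id, fun _ => le_rfl⟩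
  comp f g := ⟨f.map ∘ g.map, fun κ => (f.le _).trans (g.le κ)⟩

/-- The semantic universe: presheaves (of sets) on the category of worlds. -/
abbrev PSh := Worldᵒᵖ ⥤ Type

/-- The action `ρ^*` of a morphism of worlds on clock names. -/
def act {V U : World} (ρ : V ⟶ U) (κ : Fin U.size) : Fin V.size := World.Hom.map ρ κ

theorem act_id {U : World} (κ : Fin U.size) : act (𝟙 U) κ = κ := rfl

theorem act_comp {W V U : World} (σ : W ⟶ V) (ρ : V ⟶ U) (κ : Fin U.size) :
    act (σ ≫ ρ) κ = act σ (act ρ κ) := rfl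

/-- The object of clock names. -/
def Clk : PSh where
  obj U := Fin U.unop.size
  map f := TypeCat.ofHom (fun κ => act f.unop κ)

/-- `(U, ∂[κ ↦ ∂ κ - 1])`, only used when `∂ κ` is a successor. -/
def World.tick (U : World) (κ : Fin U.size) : World where
  size := U.size
  pos := U.pos
  time := Function.update U.time κ (U.time κ - 1)

/-- The morphism `[κ += 1]`. -/
def World.tickHom (U : World) (κ : Fin U.size) : U.tick κ ⟶ U :=
  World.Hom.mk (V := U.tick κ) (U := U) id (fun j => by
    show Function.update U.time κ (U.time κ - 1) j ≤ U.time j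
    by_cases h : j = κ
    · subst h; simp
    · simp [Function.update_of_ne h])

/-- The forcing clause of the later modality: `U ⊩ ▷κ φ`, where `φ` is given by its truth values at
the worlds over `U`. -/
def Later {U : World} (κ : Fin U.size) (φ : ∀ V : World, (V ⟶ U) → Prop) : Prop :=
  if U.time κ = 0 then True else φ (U.tick κ) (U.tickHom κ)

theorem World.tick_le {U V : World} (ρ : V ⟶ U) (κ j : Fin U.size) :
    Function.update V.time (act ρ κ) (V.time (act ρ κ) - 1) (act ρ j) ≤
      Function.update U.time κ (U.time κ - 1) j := by
  have hle : V.time (act ρ κ) ≤ U.time κ := World.Hom.le ρ κ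
  have hj : V.time (act ρ j) ≤ U.time j := World.Hom.le ρ j
  by_cases e : j = κ
  · subst e; simp; omega
  · rw [Function.update_of_ne e]
    by_cases e' : act ρ j = act ρ κ
    · rw [e', Function.update_self]; rw [e'] at hj; omega
    · rw [Function.update_of_ne e']; exact hj

theorem Later.mono {U V : World} (ρ : V ⟶ U) (κ : Fin U.size) {φ : ∀ W : World, (W ⟶ U) → Prop}
    {ψ : ∀ W : World, (W ⟶ V) → Prop}
    (h : ∀ W W' (α : W ⟶ U) (β : W' ⟶ V) (τ : W' ⟶ W), τ ≫ α = β ≫ ρ → φ W α → ψ W' β) :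
    Later κ φ → Later (act ρ κ) ψ := by
  intro hφ
  unfold Later at *
  by_cases h0 : V.time (act ρ κ) = 0
  · rw [if_pos h0]; trivial
  · rw [if_neg h0]
    have hle : V.time (act ρ κ) ≤ U.time κ := World.Hom.le ρ κ
    have h1 : U.time κ ≠ 0 := by omega
    rw [if_neg h1] at hφ
    exact h _ _ (U.tickHom κ) (V.tickHom (act ρ κ)) ⟨_, World.tick_le ρ κ⟩ rfl hφ

theorem Later.imp {U : World} {κ : Fin U.size} {φ ψ : ∀ W : World, (W ⟶ U) → Prop}
    (h : ∀ W (α : W ⟶ U), φ W α → ψ W α) : Later κ φ → Later κ ψ := by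
  unfold Later
  split_ifs
  · exact id
  · exact h _ _

/-! ## Power objects and exponentials -/

section Power

variable {X Y : PSh} {U V W : World}

/-- The elements at `U` of the power object of `X`: the subobjects of `y(U) × X`. -/
abbrev PowAt (X : PSh) (U : World) := Subfunctor (FunctorToTypes.prod (yoneda.obj U) X)

/-- `V ⊩ x ∈ ρ^* S`. -/
def PowAt.mem (S : PowAt X U) {V : World} (ρ : V ⟶ U) (x : X.obj (op V)) : Prop :=
  (ρ, x) ∈ S.obj (op V)

/-- Comprehension. -/
def PowAt.mk (P : ∀ V : World, (V ⟶ U) → X.obj (op V) → Prop)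
    (h : ∀ (V W : World) (ρ : V ⟶ U) (σ : W ⟶ V) (x : X.obj (op V)),
      P V ρ x → P W (σ ≫ ρ) (X.map σ.op x)) : PowAt X U where
  obj V := {p | P V.unop p.1 p.2}
  map {V W} i p hp := h V.unop W.unop p.1 i.unop p.2 hp

theorem PowAt.mem_mk {P : ∀ V : World, (V ⟶ U) → X.obj (op V) → Prop} {h}
    {ρ : V ⟶ U} {x : X.obj (op V)} : (PowAt.mk P h).mem ρ x ↔ P V ρ x := Iff.rfl

theorem PowAt.mem_map (S : PowAt X U) (ρ : V ⟶ U) (σ : W ⟶ V) {x : X.obj (op V)}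
    (h : S.mem ρ x) : S.mem (σ ≫ ρ) (X.map σ.op x) := S.map σ.op h

theorem PowAt.ext {S T : PowAt X U}
    (h : ∀ (V : World) (ρ : V ⟶ U) (x : X.obj (op V)), S.mem ρ x ↔ T.mem ρ x) : S = T := by
  refine Subfunctor.ext (funext fun V => Set.ext fun p => ?_)
  exact h V.unop p.1 p.2

theorem PowAt.le_iff {S T : PowAt X U} :
    S ≤ T ↔ ∀ (V : World) (ρ : V ⟶ U) (x : X.obj (op V)), S.mem ρ x → T.mem ρ x :=
  ⟨fun h V _ _ hx => h (op V) hx, fun h V p hp => h V.unop p.1 p.2 hp⟩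

/-- Restriction `ρ^* S`. -/
def PowAt.res (ρ : V ⟶ U) (S : PowAt X U) : PowAt X V :=
  PowAt.mk (fun _ σ x => S.mem (σ ≫ ρ) x) (fun _ _ σ τ _ h => S.mem_map (σ ≫ ρ) τ h)

theorem PowAt.mem_res {ρ : V ⟶ U} {S : PowAt X U} {σ : W ⟶ V} {x : X.obj (op W)} :
    (S.res ρ).mem σ x ↔ S.mem (σ ≫ ρ) x := Iff.rfl

theorem PowAt.res_id (S : PowAt X U) : S.res (𝟙 U) = S :=
  PowAt.ext fun _ _ _ => Iff.rfl

theorem PowAt.res_res (S : PowAt X U) (ρ : V ⟶ U) (σ : W ⟶ V) :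
    (S.res ρ).res σ = S.res (σ ≫ ρ) :=
  PowAt.ext fun _ _ _ => Iff.rfl

theorem PowAt.res_mono (ρ : V ⟶ U) {S T : PowAt X U} (h : S ≤ T) : S.res ρ ≤ T.res ρ :=
  PowAt.le_iff.2 fun _ _ _ hx => PowAt.le_iff.1 h _ _ _ hx

/-- The power object `Pow X`. -/
def Pow (X : PSh) : PSh where
  obj U := PowAt X U.unop
  map f := TypeCat.ofHom (fun S => S.res f.unop)

/-- Restriction of subobjects commutes with least fixed points, so that a least fixed point
computed at each world is the least fixed point in the internal logic. -/
theorem PowAt.lfp_res (ρ : V ⟶ U) (F : PowAt X U →o PowAt X U) (G : PowAt X V →o PowAt X V)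
    (h : ∀ S, (F S).res ρ = G (S.res ρ)) : (OrderHom.lfp F).res ρ = OrderHom.lfp G := by
  apply le_antisymm
  · let T : PowAt X U := PowAt.mk
      (fun W σ x => ∀ (W' : World) (α : W' ⟶ W) (β : W' ⟶ V), α ≫ σ = β ≫ ρ →
        (OrderHom.lfp G).mem β (X.map α.op x))
      (fun W W' σ τ x hx W'' α β e => by
        have := hx W'' (α ≫ τ) β (by rw [Category.assoc, e])
        rwa [op_comp, X.map_comp] at this)
    have hT : T.res ρ ≤ OrderHom.lfp G := PowAt.le_iff.2 fun W σ x hx => by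
      have := hx W (𝟙 W) σ (by simp)
      rwa [op_id, X.map_id] at this
    have hF : F T ≤ T := PowAt.le_iff.2 fun W σ x hx W' α β e => by
      have h1 : (F T).mem (β ≫ ρ) (X.map α.op x) := by
        rw [← e]; exact (F T).mem_map σ α hx
      have h2 : (G (T.res ρ)).mem β (X.map α.op x) := by rw [← h]; exact h1
      have h3 : G (T.res ρ) ≤ OrderHom.lfp G := by
        conv_rhs => rw [← OrderHom.map_lfp]
        exact G.mono hT
      exact PowAt.le_iff.1 h3 _ _ _ h2
    exact (PowAt.res_mono ρ (OrderHom.lfp_le F hF)).trans hT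
  · apply OrderHom.lfp_le
    rw [← h, OrderHom.map_lfp]

/-- The elements at `U` of the exponential `Y ^ X`: natural transformations `y(U) × X ⟶ Y`. -/
structure ExpAt (X Y : PSh) (U : World) where
  app : ∀ V : World, (V ⟶ U) → X.obj (op V) → Y.obj (op V)
  nat : ∀ (V W : World) (ρ : V ⟶ U) (σ : W ⟶ V) (x : X.obj (op V)),
    Y.map σ.op (app V ρ x) = app W (σ ≫ ρ) (X.map σ.op x)

/-- Restriction in an exponential. -/
def ExpAt.res (ρ : V ⟶ U) (f : ExpAt X Y U) : ExpAt X Y V where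
  app W σ x := f.app W (σ ≫ ρ) x
  nat W W' σ τ x := f.nat W W' (σ ≫ ρ) τ x

end Power

/-! ## Programs -/

/-- Raw programs with `n` free variables (de Bruijn indices) at a world `U`. An operator that binds
a clock takes a family indexed by all morphisms `V ⟶ U` and all clock names of `V`; naturality of
these families is imposed afterwards. -/
inductive Raw : World → ℕ → Type
  | var {U : World} {n : ℕ} (i : Fin n) : Raw U n
  | lam {U : World} {n : ℕ} (M : Raw U (n + 1)) : Raw U n
  | klam {U : World} {n : ℕ} (M : ∀ V : World, (V ⟶ U) → Fin V.size → Raw V n) : Raw U n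
  | app {U : World} {n : ℕ} (M N : Raw U n) : Raw U n
  | kapp {U : World} {n : ℕ} (M : Raw U n) (κ : Fin U.size) : Raw U n
  | pair {U : World} {n : ℕ} (M N : Raw U n) : Raw U n
  | fst {U : World} {n : ℕ} (M : Raw U n) : Raw U n
  | snd {U : World} {n : ℕ} (M : Raw U n) : Raw U n
  | fix {U : World} {n : ℕ} (M : Raw U (n + 1)) : Raw U n
  | star {U : World} {n : ℕ} : Raw U n
  | tt {U : World} {n : ℕ} : Raw U n
  | ff {U : World} {n : ℕ} : Raw U n
  | ite {U : World} {n : ℕ} (M N O : Raw U n) : Raw U n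
  | ze {U : World} {n : ℕ} : Raw U n
  | su {U : World} {n : ℕ} (M : Raw U n) : Raw U n
  | ifze {U : World} {n : ℕ} (M N : Raw U n) (O : Raw U (n + 1)) : Raw U n
  | sup {U : World} {n : ℕ} (M : Raw U n) (N : Raw U (n + 1)) : Raw U n
  | wrec {U : World} {n : ℕ} (M : Raw U n) (N : Raw U (n + 3)) : Raw U n
  | pi {U : World} {n : ℕ} (A : Raw U n) (B : Raw U (n + 1)) : Raw U n
  | sg {U : World} {n : ℕ} (A : Raw U n) (B : Raw U (n + 1)) : Raw U n
  | wty {U : World} {n : ℕ} (A : Raw U n) (B : Raw U (n + 1)) : Raw U n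
  | eq {U : World} {n : ℕ} (A M N : Raw U n) : Raw U n
  | kpi {U : World} {n : ℕ} (A : ∀ V : World, (V ⟶ U) → Fin V.size → Raw V n) : Raw U n
  | isect {U : World} {n : ℕ} (A : ∀ V : World, (V ⟶ U) → Fin V.size → Raw V n) : Raw U n
  | later {U : World} {n : ℕ} (κ : Fin U.size) (A : Raw U n) : Raw U n
  | void {U : World} {n : ℕ} : Raw U n
  | unit {U : World} {n : ℕ} : Raw U n
  | bool {U : World} {n : ℕ} : Raw U n
  | nat {U : World} {n : ℕ} : Raw U n
  | univ {U : World} {n : ℕ} (i : ℕ) : Raw U n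

/-- The extension of a renaming under a binder; the bound variable has index `0`. -/
def liftRen {m n : ℕ} (f : Fin m → Fin n) : Fin (m + 1) → Fin (n + 1) :=
  Fin.cases 0 (fun i => (f i).succ)

namespace Raw

/-- Restriction of raw programs along a morphism of worlds. -/
def res : {U : World} → {n : ℕ} → {V : World} → (V ⟶ U) → Raw U n → Raw V n
  | _, _, _, _, var i => var i
  | _, _, _, ρ, lam M => lam (M.res ρ)
  | _, _, _, ρ, klam M => klam (fun W σ κ => M W (σ ≫ ρ) κ)
  | _, _, _, ρ, app M N => app (M.res ρ) (N.res ρ)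
  | _, _, _, ρ, kapp M κ => kapp (M.res ρ) (act ρ κ)
  | _, _, _, ρ, pair M N => pair (M.res ρ) (N.res ρ)
  | _, _, _, ρ, fst M => fst (M.res ρ)
  | _, _, _, ρ, snd M => snd (M.res ρ)
  | _, _, _, ρ, fix M => fix (M.res ρ)
  | _, _, _, _, star => star
  | _, _, _, _, tt => tt
  | _, _, _, _, ff => ff
  | _, _, _, ρ, ite M N O => ite (M.res ρ) (N.res ρ) (O.res ρ)
  | _, _, _, _, ze => ze
  | _, _, _, ρ, su M => su (M.res ρ)
  | _, _, _, ρ, ifze M N O => ifze (M.res ρ) (N.res ρ) (O.res ρ)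
  | _, _, _, ρ, sup M N => sup (M.res ρ) (N.res ρ)
  | _, _, _, ρ, wrec M N => wrec (M.res ρ) (N.res ρ)
  | _, _, _, ρ, pi A B => pi (A.res ρ) (B.res ρ)
  | _, _, _, ρ, sg A B => sg (A.res ρ) (B.res ρ)
  | _, _, _, ρ, wty A B => wty (A.res ρ) (B.res ρ)
  | _, _, _, ρ, eq A M N => eq (A.res ρ) (M.res ρ) (N.res ρ)
  | _, _, _, ρ, kpi A => kpi (fun W σ κ => A W (σ ≫ ρ) κ)
  | _, _, _, ρ, isect A => isect (fun W σ κ => A W (σ ≫ ρ) κ)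
  | _, _, _, ρ, later κ A => later (act ρ κ) (A.res ρ)
  | _, _, _, _, void => void
  | _, _, _, _, unit => unit
  | _, _, _, _, bool => bool
  | _, _, _, _, nat => nat
  | _, _, _, _, univ i => univ i

/-- Hereditary naturality of the families under clock binders. -/
def Natural : {U : World} → {n : ℕ} → Raw U n → Prop
  | _, _, var _ => True
  | _, _, lam M => M.Natural
  | U, _, klam M => (∀ (V : World) (ρ : V ⟶ U) (κ : Fin V.size), (M V ρ κ).Natural) ∧
      ∀ (V W : World) (ρ : V ⟶ U) (σ : W ⟶ V) (κ : Fin V.size),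
        (M V ρ κ).res σ = M W (σ ≫ ρ) (act σ κ)
  | _, _, app M N => M.Natural ∧ N.Natural
  | _, _, kapp M _ => M.Natural
  | _, _, pair M N => M.Natural ∧ N.Natural
  | _, _, fst M => M.Natural
  | _, _, snd M => M.Natural
  | _, _, fix M => M.Natural
  | _, _, star => True
  | _, _, tt => True
  | _, _, ff => True
  | _, _, ite M N O => M.Natural ∧ N.Natural ∧ O.Natural
  | _, _, ze => True
  | _, _, su M => M.Natural
  | _, _, ifze M N O => M.Natural ∧ N.Natural ∧ O.Natural
  | _, _, sup M N => M.Natural ∧ N.Natural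
  | _, _, wrec M N => M.Natural ∧ N.Natural
  | _, _, pi A B => A.Natural ∧ B.Natural
  | _, _, sg A B => A.Natural ∧ B.Natural
  | _, _, wty A B => A.Natural ∧ B.Natural
  | _, _, eq A M N => A.Natural ∧ M.Natural ∧ N.Natural
  | U, _, kpi A => (∀ (V : World) (ρ : V ⟶ U) (κ : Fin V.size), (A V ρ κ).Natural) ∧
      ∀ (V W : World) (ρ : V ⟶ U) (σ : W ⟶ V) (κ : Fin V.size),
        (A V ρ κ).res σ = A W (σ ≫ ρ) (act σ κ)
  | U, _, isect A => (∀ (V : World) (ρ : V ⟶ U) (κ : Fin V.size), (A V ρ κ).Natural) ∧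
      ∀ (V W : World) (ρ : V ⟶ U) (σ : W ⟶ V) (κ : Fin V.size),
        (A V ρ κ).res σ = A W (σ ≫ ρ) (act σ κ)
  | _, _, later _ A => A.Natural
  | _, _, void => True
  | _, _, unit => True
  | _, _, bool => True
  | _, _, nat => True
  | _, _, univ _ => True

/-- Renaming of variables. -/
def ren : {U : World} → {m n : ℕ} → (Fin m → Fin n) → Raw U m → Raw U n
  | _, _, _, f, var i => var (f i)
  | _, _, _, f, lam M => lam (M.ren (liftRen f))
  | _, _, _, f, klam M => klam (fun V ρ κ => (M V ρ κ).ren f)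
  | _, _, _, f, app M N => app (M.ren f) (N.ren f)
  | _, _, _, f, kapp M κ => kapp (M.ren f) κ
  | _, _, _, f, pair M N => pair (M.ren f) (N.ren f)
  | _, _, _, f, fst M => fst (M.ren f)
  | _, _, _, f, snd M => snd (M.ren f)
  | _, _, _, f, fix M => fix (M.ren (liftRen f))
  | _, _, _, _, star => star
  | _, _, _, _, tt => tt
  | _, _, _, _, ff => ff
  | _, _, _, f, ite M N O => ite (M.ren f) (N.ren f) (O.ren f)
  | _, _, _, _, ze => ze
  | _, _, _, f, su M => su (M.ren f)
  | _, _, _, f, ifze M N O => ifze (M.ren f) (N.ren f) (O.ren (liftRen f))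
  | _, _, _, f, sup M N => sup (M.ren f) (N.ren (liftRen f))
  | _, _, _, f, wrec M N => wrec (M.ren f) (N.ren (liftRen (liftRen (liftRen f))))
  | _, _, _, f, pi A B => pi (A.ren f) (B.ren (liftRen f))
  | _, _, _, f, sg A B => sg (A.ren f) (B.ren (liftRen f))
  | _, _, _, f, wty A B => wty (A.ren f) (B.ren (liftRen f))
  | _, _, _, f, eq A M N => eq (A.ren f) (M.ren f) (N.ren f)
  | _, _, _, f, kpi A => kpi (fun V ρ κ => (A V ρ κ).ren f)
  | _, _, _, f, isect A => isect (fun V ρ κ => (A V ρ κ).ren f)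
  | _, _, _, f, later κ A => later κ (A.ren f)
  | _, _, _, _, void => void
  | _, _, _, _, unit => unit
  | _, _, _, _, bool => bool
  | _, _, _, _, nat => nat
  | _, _, _, _, univ i => univ i

/-- The extension of a substitution under a binder. -/
def liftSub {U : World} {m n : ℕ} (γ : Fin m → Raw U n) : Fin (m + 1) → Raw U (n + 1) :=
  Fin.cases (var 0) (fun i => (γ i).ren Fin.succ)

/-- Simultaneous substitution. -/
def subst : {U : World} → {m n : ℕ} → (Fin m → Raw U n) → Raw U m → Raw U n
  | _, _, _, γ, var i => γ i
  | _, _, _, γ, lam M => lam (M.subst (liftSub γ))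
  | _, _, _, γ, klam M => klam (fun V ρ κ => (M V ρ κ).subst (fun i => (γ i).res ρ))
  | _, _, _, γ, app M N => app (M.subst γ) (N.subst γ)
  | _, _, _, γ, kapp M κ => kapp (M.subst γ) κ
  | _, _, _, γ, pair M N => pair (M.subst γ) (N.subst γ)
  | _, _, _, γ, fst M => fst (M.subst γ)
  | _, _, _, γ, snd M => snd (M.subst γ)
  | _, _, _, γ, fix M => fix (M.subst (liftSub γ))
  | _, _, _, _, star => star
  | _, _, _, _, tt => tt
  | _, _, _, _, ff => ff
  | _, _, _, γ, ite M N O => ite (M.subst γ) (N.subst γ) (O.subst γ)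
  | _, _, _, _, ze => ze
  | _, _, _, γ, su M => su (M.subst γ)
  | _, _, _, γ, ifze M N O => ifze (M.subst γ) (N.subst γ) (O.subst (liftSub γ))
  | _, _, _, γ, sup M N => sup (M.subst γ) (N.subst (liftSub γ))
  | _, _, _, γ, wrec M N => wrec (M.subst γ) (N.subst (liftSub (liftSub (liftSub γ))))
  | _, _, _, γ, pi A B => pi (A.subst γ) (B.subst (liftSub γ))
  | _, _, _, γ, sg A B => sg (A.subst γ) (B.subst (liftSub γ))
  | _, _, _, γ, wty A B => wty (A.subst γ) (B.subst (liftSub γ))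
  | _, _, _, γ, eq A M N => eq (A.subst γ) (M.subst γ) (N.subst γ)
  | _, _, _, γ, kpi A => kpi (fun V ρ κ => (A V ρ κ).subst (fun i => (γ i).res ρ))
  | _, _, _, γ, isect A => isect (fun V ρ κ => (A V ρ κ).subst (fun i => (γ i).res ρ))
  | _, _, _, γ, later κ A => later κ (A.subst γ)
  | _, _, _, _, void => void
  | _, _, _, _, unit => unit
  | _, _, _, _, bool => bool
  | _, _, _, _, nat => nat
  | _, _, _, _, univ i => univ i

theorem res_id {U : World} {n : ℕ} (M : Raw U n) : M.res (𝟙 U) = M := by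
  induction M <;> simp_all [res, act_id]

theorem res_res {U : World} {n : ℕ} (M : Raw U n) {V W : World} (ρ : V ⟶ U) (σ : W ⟶ V) :
    (M.res ρ).res σ = M.res (σ ≫ ρ) := by
  induction M generalizing V W <;> simp_all [res, act_comp]

theorem res_ren {U : World} {m : ℕ} (M : Raw U m) {n : ℕ} (f : Fin m → Fin n) {V : World}
    (ρ : V ⟶ U) : (M.ren f).res ρ = (M.res ρ).ren f := by
  induction M generalizing n V <;> simp_all [res, ren]

theorem res_liftSub {U : World} {m n : ℕ} (γ : Fin m → Raw U n) {V : World} (ρ : V ⟶ U) :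
    (fun i => (liftSub γ i).res ρ) = liftSub (fun i => (γ i).res ρ) := by
  funext i
  refine Fin.cases ?_ (fun i => ?_) i
  · rfl
  · simp [liftSub, res_ren]

theorem res_subst {U : World} {m : ℕ} (M : Raw U m) {n : ℕ} (γ : Fin m → Raw U n) {V : World}
    (ρ : V ⟶ U) : (M.subst γ).res ρ = (M.res ρ).subst (fun i => (γ i).res ρ) := by
  induction M generalizing n V <;> simp_all [res, subst, res_liftSub, res_res]

theorem Natural.res {U : World} {n : ℕ} {M : Raw U n} (h : M.Natural) {V : World} (ρ : V ⟶ U) :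
    (M.res ρ).Natural := by
  induction M generalizing V with
  | klam M ih => exact ⟨fun W σ κ => h.1 _ _ _, fun W W' σ τ κ => h.2 _ _ _ _ _⟩
  | kpi M ih => exact ⟨fun W σ κ => h.1 _ _ _, fun W W' σ τ κ => h.2 _ _ _ _ _⟩
  | isect M ih => exact ⟨fun W σ κ => h.1 _ _ _, fun W W' σ τ κ => h.2 _ _ _ _ _⟩
  | _ => simp_all [Raw.res, Natural]

theorem Natural.ren {U : World} {m : ℕ} {M : Raw U m} (h : M.Natural) {n : ℕ}
    (f : Fin m → Fin n) : (M.ren f).Natural := by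
  induction M generalizing n with
  | klam M ih =>
    exact ⟨fun W σ κ => ih _ _ _ (h.1 _ _ _) f, fun W W' σ τ κ => by rw [res_ren, h.2]⟩
  | kpi M ih =>
    exact ⟨fun W σ κ => ih _ _ _ (h.1 _ _ _) f, fun W W' σ τ κ => by rw [res_ren, h.2]⟩
  | isect M ih =>
    exact ⟨fun W σ κ => ih _ _ _ (h.1 _ _ _) f, fun W W' σ τ κ => by rw [res_ren, h.2]⟩
  | _ => simp_all [Raw.ren, Natural]

theorem Natural.liftSub {U : World} {m n : ℕ} {γ : Fin m → Raw U n} (h : ∀ i, (γ i).Natural) :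
    ∀ i, (Raw.liftSub γ i).Natural :=
  Fin.cases trivial (fun i => (h i).ren _)

theorem Natural.subst {U : World} {m : ℕ} {M : Raw U m} (h : M.Natural) {n : ℕ}
    {γ : Fin m → Raw U n} (hγ : ∀ i, (γ i).Natural) : (M.subst γ).Natural := by
  induction M generalizing n with
  | klam M ih =>
    exact ⟨fun W σ κ => ih _ _ _ (h.1 _ _ _) (fun i => (hγ i).res _),
      fun W W' σ τ κ => by simp only [res_subst, h.2, res_res]⟩
  | kpi M ih =>
    exact ⟨fun W σ κ => ih _ _ _ (h.1 _ _ _) (fun i => (hγ i).res _),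
      fun W W' σ τ κ => by simp only [res_subst, h.2, res_res]⟩
  | isect M ih =>
    exact ⟨fun W σ κ => ih _ _ _ (h.1 _ _ _) (fun i => (hγ i).res _),
      fun W W' σ τ κ => by simp only [res_subst, h.2, res_res]⟩
  | var i => exact hγ i
  | wrec M N ihM ihN =>
    exact ⟨ihM h.1 hγ, ihN h.2 (Natural.liftSub (Natural.liftSub (Natural.liftSub hγ)))⟩
  | _ => simp_all [Raw.subst, Natural, Natural.liftSub]

/-! ### Operational semantics -/

/-- Canonical forms. -/
def IsVal {U : World} : Raw U 0 → Prop
  | lam _ | klam _ | pair _ _ | star | tt | ff | ze | su _ | sup _ _ | pi _ _ | sg _ _ | wty _ _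
  | eq _ _ _ | kpi _ | isect _ | later _ _ | void | unit | bool | nat | univ _ => True
  | _ => False

/-- One step of computation of closed programs. In the rule for the recursor of wellordering types,
the three variables of `O` (of indices `2, 1, 0`) stand for the label, the function giving the
subtrees, and the function giving the results of the recursive calls. -/
inductive Step {U : World} : Raw U 0 → Raw U 0 → Prop
  | app_cong {M M' N : Raw U 0} : Step M M' → Step (app M N) (app M' N)
  | kapp_cong {M M' : Raw U 0} {κ : Fin U.size} : Step M M' → Step (kapp M κ) (kapp M' κ)
  | fst_cong {M M' : Raw U 0} : Step M M' → Step (fst M) (fst M')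
  | snd_cong {M M' : Raw U 0} : Step M M' → Step (snd M) (snd M')
  | ite_cong {M M' N O : Raw U 0} : Step M M' → Step (ite M N O) (ite M' N O)
  | ifze_cong {M M' N : Raw U 0} {O : Raw U 1} : Step M M' → Step (ifze M N O) (ifze M' N O)
  | wrec_cong {M M' : Raw U 0} {O : Raw U 3} : Step M M' → Step (wrec M O) (wrec M' O)
  | beta {M : Raw U 1} {N : Raw U 0} : Step (app (lam M) N) (M.subst (fun _ => N))
  | kbeta {M : ∀ V : World, (V ⟶ U) → Fin V.size → Raw V 0} {κ : Fin U.size} :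
      Step (kapp (klam M) κ) (M U (𝟙 U) κ)
  | fst_pair {M N : Raw U 0} : Step (fst (pair M N)) M
  | snd_pair {M N : Raw U 0} : Step (snd (pair M N)) N
  | ite_tt {N O : Raw U 0} : Step (ite tt N O) N
  | ite_ff {N O : Raw U 0} : Step (ite ff N O) O
  | ifze_ze {N : Raw U 0} {O : Raw U 1} : Step (ifze ze N O) N
  | ifze_su {M N : Raw U 0} {O : Raw U 1} : Step (ifze (su M) N O) (O.subst (fun _ => M))
  | wrec_sup {M : Raw U 0} {N : Raw U 1} {O : Raw U 3} :
      Step (wrec (sup M N) O)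
        (O.subst ![lam (wrec N (O.ren (liftRen (liftRen (liftRen Fin.succ))))), lam N, M])
  | fix {M : Raw U 1} : Step (fix M) (M.subst (fun _ => fix M))

theorem IsVal.res {U V : World} (ρ : V ⟶ U) {M : Raw U 0} (h : M.IsVal) : (M.res ρ).IsVal := by
  cases M <;> simp_all [IsVal, Raw.res]

theorem Step.res {U V : World} (ρ : V ⟶ U) {M N : Raw U 0} (h : Step M N) (hM : M.Natural) :
    Step (M.res ρ) (N.res ρ) := by
  induction h with
  | app_cong _ ih => exact .app_cong (ih hM.1)
  | kapp_cong _ ih => exact .kapp_cong (ih hM)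
  | fst_cong _ ih => exact .fst_cong (ih hM)
  | snd_cong _ ih => exact .snd_cong (ih hM)
  | ite_cong _ ih => exact .ite_cong (ih hM.1)
  | ifze_cong _ ih => exact .ifze_cong (ih hM.1)
  | wrec_cong _ ih => exact .wrec_cong (ih hM.1)
  | beta => rw [res_subst]; exact .beta
  | kbeta => rw [hM.2]; exact .kbeta
  | fst_pair => exact .fst_pair
  | snd_pair => exact .snd_pair
  | ite_tt => exact .ite_tt
  | ite_ff => exact .ite_ff
  | ifze_ze => exact .ifze_ze
  | ifze_su => rw [res_subst]; exact .ifze_su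
  | @wrec_sup M N O =>
    rw [res_subst]
    have : (fun i => Raw.res ρ ((![lam (wrec N (O.ren (liftRen (liftRen (liftRen Fin.succ))))),
        lam N, M] : Fin 3 → Raw U 0) i)) =
        ![lam (wrec (N.res ρ) ((O.res ρ).ren (liftRen (liftRen (liftRen Fin.succ))))),
          lam (N.res ρ), M.res ρ] := by
      funext i
      fin_cases i
      · simp [Raw.res, res_ren]
      · rfl
      · rfl
    exact this ▸ Step.wrec_sup
  | fix => rw [res_subst]; exact .fix

theorem Step.natural {U : World} {M N : Raw U 0} (h : Step M N) (hM : M.Natural) : N.Natural := by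
  induction h with
  | app_cong _ ih => exact ⟨ih hM.1, hM.2⟩
  | kapp_cong _ ih => exact ih hM
  | fst_cong _ ih => exact ih hM
  | snd_cong _ ih => exact ih hM
  | ite_cong _ ih => exact ⟨ih hM.1, hM.2⟩
  | ifze_cong _ ih => exact ⟨ih hM.1, hM.2⟩
  | wrec_cong _ ih => exact ⟨ih hM.1, hM.2⟩
  | @beta M _ => exact Natural.subst (M := M) hM.1 (fun _ => hM.2)
  | kbeta => exact hM.1 _ _ _
  | fst_pair => exact hM.1
  | snd_pair => exact hM.2
  | ite_tt => exact hM.2.1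
  | ite_ff => exact hM.2.2
  | ifze_ze => exact hM.2.1
  | ifze_su => exact Natural.subst hM.2.2 (fun _ => hM.1)
  | wrec_sup =>
    refine Natural.subst hM.2 (fun i => ?_)
    fin_cases i
    · exact ⟨hM.1.2, hM.2.ren _⟩
    · exact hM.1.2
    · exact hM.1.1
  | @fix M => exact Natural.subst (M := M) hM (fun _ => hM)

end Raw

/-- Programs with `n` free variables at the world `U`. -/
def Tm (U : World) (n : ℕ) : Type := {M : Raw U n // M.Natural}

namespace Tm

variable {U V W : World} {m n : ℕ}

/-- Restriction of programs. -/
def res (ρ : V ⟶ U) (M : Tm U n) : Tm V n := ⟨M.1.res ρ, M.2.res ρ⟩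

/-- Simultaneous substitution in programs. -/
def subst (γ : Fin m → Tm U n) (M : Tm U m) : Tm U n :=
  ⟨M.1.subst (fun i => (γ i).1), M.2.subst (fun i => (γ i).2)⟩

/-- Instantiation of the only variable of a program. -/
def inst (M : Tm U 0) (B : Tm U 1) : Tm U 0 := B.subst (fun _ => M)

theorem res_id (M : Tm U n) : M.res (𝟙 U) = M := Subtype.ext M.1.res_id

theorem res_res (M : Tm U n) (ρ : V ⟶ U) (σ : W ⟶ V) : (M.res ρ).res σ = M.res (σ ≫ ρ) :=
  Subtype.ext (M.1.res_res ρ σ)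

theorem res_subst (γ : Fin m → Tm U n) (M : Tm U m) (ρ : V ⟶ U) :
    (M.subst γ).res ρ = (M.res ρ).subst (fun i => (γ i).res ρ) :=
  Subtype.ext (M.1.res_subst _ ρ)

theorem res_inst (M : Tm U 0) (B : Tm U 1) (ρ : V ⟶ U) :
    (inst M B).res ρ = inst (M.res ρ) (B.res ρ) := res_subst _ _ _

end Tm

/-- The object of programs with `n` free variables. -/
def Prog (n : ℕ) : PSh where
  obj U := Tm U.unop n
  map f := TypeCat.ofHom (fun M => M.res f.unop)
  map_id U := by ext M; exact Tm.res_id M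
  map_comp f g := by ext M; exact (Tm.res_res M f.unop g.unop).symm

namespace Tm

variable {U V W : World} {n : ℕ}

def app (M N : Tm U n) : Tm U n := ⟨.app M.1 N.1, M.2, N.2⟩
def kapp (M : Tm U n) (κ : Fin U.size) : Tm U n := ⟨.kapp M.1 κ, M.2⟩
def fst (M : Tm U n) : Tm U n := ⟨.fst M.1, M.2⟩
def snd (M : Tm U n) : Tm U n := ⟨.snd M.1, M.2⟩
def star : Tm U n := ⟨.star, trivial⟩
def tt : Tm U n := ⟨.tt, trivial⟩
def ff : Tm U n := ⟨.ff, trivial⟩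
def ze : Tm U n := ⟨.ze, trivial⟩
def su (M : Tm U n) : Tm U n := ⟨.su M.1, M.2⟩
def sup (M : Tm U n) (N : Tm U (n + 1)) : Tm U n := ⟨.sup M.1 N.1, M.2, N.2⟩
def pi (A : Tm U n) (B : Tm U (n + 1)) : Tm U n := ⟨.pi A.1 B.1, A.2, B.2⟩
def sg (A : Tm U n) (B : Tm U (n + 1)) : Tm U n := ⟨.sg A.1 B.1, A.2, B.2⟩
def wty (A : Tm U n) (B : Tm U (n + 1)) : Tm U n := ⟨.wty A.1 B.1, A.2, B.2⟩
def eq (A M N : Tm U n) : Tm U n := ⟨.eq A.1 M.1 N.1, A.2, M.2, N.2⟩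
def kpi (A : ExpAt Clk (Prog n) U) : Tm U n :=
  ⟨.kpi (fun V ρ κ => (A.app V ρ κ).1), fun V ρ κ => (A.app V ρ κ).2,
    fun V W ρ σ κ => congrArg Subtype.val (A.nat V W ρ σ κ)⟩
def isect (A : ExpAt Clk (Prog n) U) : Tm U n :=
  ⟨.isect (fun V ρ κ => (A.app V ρ κ).1), fun V ρ κ => (A.app V ρ κ).2,
    fun V W ρ σ κ => congrArg Subtype.val (A.nat V W ρ σ κ)⟩
def later (κ : Fin U.size) (A : Tm U n) : Tm U n := ⟨.later κ A.1, A.2⟩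
def void : Tm U n := ⟨.void, trivial⟩
def unit : Tm U n := ⟨.unit, trivial⟩
def bool : Tm U n := ⟨.bool, trivial⟩
def nat : Tm U n := ⟨.nat, trivial⟩
def univ (i : ℕ) : Tm U n := ⟨.univ i, trivial⟩

/-- `M` is a value. -/
def IsVal (M : Tm U 0) : Prop := M.1.IsVal

/-- One step of computation. -/
def Step (M N : Tm U 0) : Prop := Raw.Step M.1 N.1

/-- The program `M` computes to the value `N`. -/
def Evals (M N : Tm U 0) : Prop := Relation.ReflTransGen Step M N ∧ N.IsVal

theorem Evals.res {M N : Tm U 0} (h : M.Evals N) (ρ : V ⟶ U) : (M.res ρ).Evals (N.res ρ) :=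
  ⟨by
    refine Relation.ReflTransGen.head_induction_on h.1 .refl fun {a b} h' _ ih => ?_
    have h'' : Step (a.res ρ) (b.res ρ) := Raw.Step.res ρ h' a.2
    exact .head h'' ih, Raw.IsVal.res ρ h.2⟩

end Tm

/-! ## Candidate type systems -/

/-- The object of relations on closed programs. -/
abbrev RelP : PSh := Pow (FunctorToTypes.prod (Prog 0) (Prog 0))

/-- Relations on closed programs, at the world `U`. -/
abbrev RelAt (U : World) := PowAt (FunctorToTypes.prod (Prog 0) (Prog 0)) U

/-- Candidate type systems at the world `U`: relations between closed programs and relations on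
closed programs. -/
abbrev PTS (U : World) := PowAt (FunctorToTypes.prod (Prog 0) RelP) U

section Candidates

variable {U V W : World}

/-- `V ⊩ (M, N) ∈ ρ^* R`. -/
def RelAt.rel (R : RelAt U) (ρ : V ⟶ U) (M N : Tm V 0) : Prop := PowAt.mem R ρ (M, N)

/-- `V ⊩ (A, R) ∈ ρ^* τ`. -/
def PTS.has (τ : PTS U) (ρ : V ⟶ U) (A : Tm V 0) (R : RelAt V) : Prop := PowAt.mem τ ρ (A, R)

/-- Comprehension of relations. -/
def RelAt.mk (P : ∀ V : World, (V ⟶ U) → Tm V 0 → Tm V 0 → Prop)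
    (h : ∀ (V W : World) (ρ : V ⟶ U) (σ : W ⟶ V) (M N : Tm V 0),
      P V ρ M N → P W (σ ≫ ρ) (M.res σ) (N.res σ)) : RelAt U :=
  PowAt.mk (fun V ρ x => P V ρ x.1 x.2) (fun V W ρ σ x hx => h V W ρ σ x.1 x.2 hx)

/-- Comprehension of candidate type systems. -/
def PTS.mk (P : ∀ V : World, (V ⟶ U) → Tm V 0 → RelAt V → Prop)
    (h : ∀ (V W : World) (ρ : V ⟶ U) (σ : W ⟶ V) (A : Tm V 0) (R : RelAt V),
      P V ρ A R → P W (σ ≫ ρ) (A.res σ) (PowAt.res σ R)) : PTS U :=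
  PowAt.mk (fun V ρ x => P V ρ x.1 x.2) (fun V W ρ σ x hx => h V W ρ σ x.1 x.2 hx)

theorem RelAt.ext {R S : RelAt U}
    (h : ∀ (V : World) (ρ : V ⟶ U) (M N : Tm V 0), R.rel ρ M N ↔ S.rel ρ M N) : R = S :=
  PowAt.ext fun V ρ x => h V ρ x.1 x.2

theorem PTS.ext {τ υ : PTS U}
    (h : ∀ (V : World) (ρ : V ⟶ U) (A : Tm V 0) (R : RelAt V), τ.has ρ A R ↔ υ.has ρ A R) :
    τ = υ :=
  PowAt.ext fun V ρ x => h V ρ x.1 x.2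

theorem RelAt.le_iff {R S : RelAt U} :
    R ≤ S ↔ ∀ (V : World) (ρ : V ⟶ U) (M N : Tm V 0), R.rel ρ M N → S.rel ρ M N :=
  PowAt.le_iff.trans ⟨fun h V ρ M N => h V ρ (M, N), fun h V ρ x => h V ρ x.1 x.2⟩

theorem PTS.le_iff {τ υ : PTS U} :
    τ ≤ υ ↔ ∀ (V : World) (ρ : V ⟶ U) (A : Tm V 0) (R : RelAt V), τ.has ρ A R → υ.has ρ A R :=
  PowAt.le_iff.trans ⟨fun h V ρ M N => h V ρ (M, N), fun h V ρ x => h V ρ x.1 x.2⟩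

theorem RelAt.rel_res (R : RelAt U) {ρ : V ⟶ U} {M N : Tm V 0} (h : R.rel ρ M N) (σ : W ⟶ V) :
    R.rel (σ ≫ ρ) (M.res σ) (N.res σ) := PowAt.mem_map R ρ σ h

theorem PTS.has_res (τ : PTS U) {ρ : V ⟶ U} {A : Tm V 0} {R : RelAt V} (h : τ.has ρ A R)
    (σ : W ⟶ V) : τ.has (σ ≫ ρ) (A.res σ) (PowAt.res σ R) := PowAt.mem_map τ ρ σ h

theorem PTS.has_of_le {τ υ : PTS U} (h : τ ≤ υ) {ρ : V ⟶ U} {A : Tm V 0} {R : RelAt V} :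
    τ.has ρ A R → υ.has ρ A R := PTS.le_iff.1 h V ρ A R

/-- Closure of a relation under evaluation to canonical form. -/
def RelAt.valClo (R : RelAt U) : RelAt U :=
  RelAt.mk (fun V ρ M N => ∃ M' N' : Tm V 0, M.Evals M' ∧ N.Evals N' ∧ R.rel ρ M' N')
    (fun _ _ _ σ _ _ ⟨M', N', h, h', hR⟩ =>
      ⟨M'.res σ, N'.res σ, h.res σ, h'.res σ, R.rel_res hR σ⟩)

/-- Closure of a candidate type system under evaluation to canonical form. -/
def PTS.valClo (τ : PTS U) : PTS U :=
  PTS.mk (fun V ρ A R => ∃ A' : Tm V 0, A.Evals A' ∧ τ.has ρ A' R)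
    (fun _ _ _ σ _ _ ⟨A', h, hR⟩ => ⟨A'.res σ, h.res σ, τ.has_res hR σ⟩)

theorem RelAt.valClo_mono {R S : RelAt U} (h : R ≤ S) : R.valClo ≤ S.valClo :=
  RelAt.le_iff.2 fun _ _ _ _ ⟨M', N', h1, h2, h3⟩ => ⟨M', N', h1, h2, RelAt.le_iff.1 h _ _ _ _ h3⟩

theorem PTS.valClo_mono {τ υ : PTS U} (h : τ ≤ υ) : τ.valClo ≤ υ.valClo :=
  PTS.le_iff.2 fun _ _ _ _ ⟨A', h1, h2⟩ => ⟨A', h1, PTS.has_of_le h h2⟩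

/-! ### The relations interpreting the connectives -/

/-- The empty relation. -/
def voidRel (U : World) : RelAt U := RelAt.mk (fun _ _ _ _ => False) (fun _ _ _ _ _ _ h => h)

/-- `{(⋆, ⋆)}`. -/
def unitRel (U : World) : RelAt U :=
  RelAt.mk (fun _ _ M N => M = Tm.star ∧ N = Tm.star)
    (by rintro V W ρ σ _ _ ⟨rfl, rfl⟩; exact ⟨rfl, rfl⟩)

/-- `{(tt, tt), (ff, ff)}`. -/
def boolRel (U : World) : RelAt U :=
  RelAt.mk (fun _ _ M N => (M = Tm.tt ∧ N = Tm.tt) ∨ (M = Tm.ff ∧ N = Tm.ff))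
    (by
      rintro V W ρ σ _ _ (⟨rfl, rfl⟩ | ⟨rfl, rfl⟩)
      · exact Or.inl ⟨rfl, rfl⟩
      · exact Or.inr ⟨rfl, rfl⟩)

/-- The operator whose least fixed point is the relation of canonical natural numbers. -/
def natOp (U : World) : RelAt U →o RelAt U where
  toFun Y := RelAt.mk
    (fun V ρ M N => (M = Tm.ze ∧ N = Tm.ze) ∨
      ∃ M' N' : Tm V 0, M = M'.su ∧ N = N'.su ∧ Y.valClo.rel ρ M' N')
    (by
      rintro V W ρ σ _ _ (⟨rfl, rfl⟩ | ⟨M', N', rfl, rfl, h⟩)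
      · exact Or.inl ⟨rfl, rfl⟩
      · exact Or.inr ⟨M'.res σ, N'.res σ, rfl, rfl, RelAt.rel_res _ h σ⟩)
  monotone' Y Z h := RelAt.le_iff.2 fun V ρ M N hx => hx.imp_right
    fun ⟨M', N', h1, h2, h3⟩ => ⟨M', N', h1, h2, RelAt.le_iff.1 (RelAt.valClo_mono h) _ _ _ _ h3⟩

/-- The relation of dependent pairs, defined negatively. -/
def sgRel (R : RelAt U) (S : ExpAt (Prog 0) RelP U) : RelAt U :=
  RelAt.mk (fun V ρ M N => R.rel ρ M.fst N.fst ∧ RelAt.rel (S.app V ρ M.fst) (𝟙 V) M.snd N.snd)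
    (fun V W ρ σ M N ⟨h1, h2⟩ => ⟨R.rel_res h1 σ, by
      have h3 := RelAt.rel_res _ h2 σ
      have h4 : PowAt.res σ (S.app V ρ M.fst) = S.app W (σ ≫ ρ) (M.fst.res σ) := S.nat V W ρ σ _
      change RelAt.rel (S.app W (σ ≫ ρ) (M.fst.res σ)) _ _ _
      rw [← h4]
      exact h3⟩)

/-- The relation of dependent functions, defined negatively. -/
def piRel (R : RelAt U) (S : ExpAt (Prog 0) RelP U) : RelAt U :=
  RelAt.mk
    (fun V ρ M N => ∀ (W : World) (σ : W ⟶ V) (M' N' : Tm W 0), R.rel (σ ≫ ρ) M' N' →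
      RelAt.rel (S.app W (σ ≫ ρ) M') (𝟙 W) ((M.res σ).app M') ((N.res σ).app N'))
    (fun V W ρ σ M N h W' σ' M' N' hR => by
      have := h W' (σ' ≫ σ) M' N' hR
      rwa [← Tm.res_res, ← Tm.res_res] at this)

/-- The operator whose least fixed point is the relation of canonical well-founded trees. -/
def wOp (R : RelAt U) (S : ExpAt (Prog 0) RelP U) : RelAt U →o RelAt U where
  toFun Y := RelAt.mk
    (fun V ρ M N => ∃ (M₀ N₀ : Tm V 0) (M₁ N₁ : Tm V 1), M = M₀.sup M₁ ∧ N = N₀.sup N₁ ∧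
      R.rel ρ M₀ N₀ ∧
      ∀ (W : World) (σ : W ⟶ V) (M' N' : Tm W 0),
        RelAt.rel (S.app V ρ M₀) σ M' N' →
        Y.valClo.rel (σ ≫ ρ) (Tm.inst M' (M₁.res σ)) (Tm.inst N' (N₁.res σ)))
    (by
      rintro V W ρ σ _ _ ⟨M₀, N₀, M₁, N₁, rfl, rfl, h, h'⟩
      refine ⟨M₀.res σ, N₀.res σ, M₁.res σ, N₁.res σ, rfl, rfl, R.rel_res h σ, ?_⟩
      intro W' σ' M' N' hS
      have h4 : PowAt.res σ (S.app V ρ M₀) = S.app W (σ ≫ ρ) (M₀.res σ) := S.nat V W ρ σ _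
      rw [← h4] at hS
      have := h' W' (σ' ≫ σ) M' N' hS
      rw [← Tm.res_res, ← Tm.res_res] at this
      exact this)
  monotone' Y Z h := RelAt.le_iff.2 fun V ρ M N ⟨M₀, N₀, M₁, N₁, h1, h2, h3, h4⟩ =>
    ⟨M₀, N₀, M₁, N₁, h1, h2, h3, fun W σ M' N' hS =>
      RelAt.le_iff.1 (RelAt.valClo_mono h) _ _ _ _ (h4 W σ M' N' hS)⟩

/-- `{(⋆, ⋆) | (M, N) ∈ R}`. -/
def eqRel (R : RelAt U) (M N : Tm U 0) : RelAt U :=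
  RelAt.mk (fun _ ρ M' N' => M' = Tm.star ∧ N' = Tm.star ∧ R.rel ρ (M.res ρ) (N.res ρ))
    (by
      rintro V W ρ σ _ _ ⟨rfl, rfl, h⟩
      refine ⟨rfl, rfl, ?_⟩
      rw [← Tm.res_res, ← Tm.res_res]
      exact R.rel_res h σ)

/-- `{(M, N) | ▷κ ((M, N) ∈ R)}`. -/
def laterRel (κ : Fin U.size) (R : RelAt U) : RelAt U :=
  RelAt.mk (fun _ ρ M N => Later (act ρ κ) (fun _ σ => R.rel (σ ≫ ρ) (M.res σ) (N.res σ)))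
    (fun V W ρ σ M N => Later.mono σ (act ρ κ) (fun W₁ W₂ α β υ e h => by
      have := R.rel_res h υ
      rw [Tm.res_res, Tm.res_res, ← Category.assoc, e, Category.assoc, ← Tm.res_res,
        ← Tm.res_res] at this
      exact this))

/-- `{(M, N) | ∀ κ. (M, N) ∈ R κ}`. -/
def isectRel (R : ExpAt Clk RelP U) : RelAt U :=
  RelAt.mk
    (fun V ρ M N => ∀ (W : World) (σ : W ⟶ V) (κ : Fin W.size),
      RelAt.rel (R.app W (σ ≫ ρ) κ) (𝟙 W) (M.res σ) (N.res σ))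
    (fun V W ρ σ M N h W' σ' κ => by
      have := h W' (σ' ≫ σ) κ
      rwa [← Tm.res_res, ← Tm.res_res] at this)

/-- `{(M, N) | ∀ κ. (M κ, N κ) ∈ R κ}`. -/
def kpiRel (R : ExpAt Clk RelP U) : RelAt U :=
  RelAt.mk
    (fun V ρ M N => ∀ (W : World) (σ : W ⟶ V) (κ : Fin W.size),
      RelAt.rel (R.app W (σ ≫ ρ) κ) (𝟙 W) ((M.res σ).kapp κ) ((N.res σ).kapp κ))
    (fun V W ρ σ M N h W' σ' κ => by
      have := h W' (σ' ≫ σ) κ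
      rwa [← Tm.res_res, ← Tm.res_res] at this)

/-! ### Closure under the connectives -/

/-- The premises of the clauses for dependent functions, dependent pairs and well-founded trees. -/
def IsFam (τ : PTS U) (A : Tm U 0) (B : Tm U 1) (R : RelAt U) (S : ExpAt (Prog 0) RelP U) : Prop :=
  τ.has (𝟙 U) A R ∧
  ∀ (V : World) (ρ : V ⟶ U) (M N : Tm V 0), R.rel ρ M N →
    τ.has ρ (Tm.inst M (B.res ρ)) (S.app V ρ M) ∧ τ.has ρ (Tm.inst N (B.res ρ)) (S.app V ρ M) ∧
    τ.has ρ (Tm.inst N (B.res ρ)) (S.app V ρ N) ∧ τ.has ρ (Tm.inst M (B.res ρ)) (S.app V ρ N)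

/-- `Conn τ T X` is the forcing at `U` of `(T, X) ∈ Conns τ`: given the types and relations of the
candidate type system `τ`, the canonical type `T` denotes the relation `X`. -/
inductive Conn {U : World} (τ : PTS U) : Tm U 0 → RelAt U → Prop
  | void : Conn τ Tm.void (voidRel U)
  | unit : Conn τ Tm.unit (unitRel U).valClo
  | bool : Conn τ Tm.bool (boolRel U).valClo
  | nat : Conn τ Tm.nat (OrderHom.lfp (natOp U)).valClo
  | sg {A : Tm U 0} {B : Tm U 1} {R : RelAt U} {S : ExpAt (Prog 0) RelP U} :
      IsFam τ A B R S → Conn τ (A.sg B) (sgRel R S)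
  | pi {A : Tm U 0} {B : Tm U 1} {R : RelAt U} {S : ExpAt (Prog 0) RelP U} :
      IsFam τ A B R S → Conn τ (A.pi B) (piRel R S)
  | wty {A : Tm U 0} {B : Tm U 1} {R : RelAt U} {S : ExpAt (Prog 0) RelP U} :
      IsFam τ A B R S → Conn τ (A.wty B) (OrderHom.lfp (wOp R S)).valClo
  | eq {A M N : Tm U 0} {R : RelAt U} : τ.has (𝟙 U) A R → R.rel (𝟙 U) M M → R.rel (𝟙 U) N N →
      Conn τ (A.eq M N) (eqRel R M N).valClo
  | later {κ : Fin U.size} {A : Tm U 0} {R : RelAt U} :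
      Later κ (fun _ ρ => τ.has ρ (A.res ρ) (PowAt.res ρ R)) →
      Conn τ (A.later κ) (laterRel κ R)
  | isect {A : ExpAt Clk (Prog 0) U} {R : ExpAt Clk RelP U} :
      (∀ (V : World) (ρ : V ⟶ U) (κ : Fin V.size), τ.has ρ (A.app V ρ κ) (R.app V ρ κ)) →
      Conn τ (Tm.isect A) (isectRel R)
  | kpi {A : ExpAt Clk (Prog 0) U} {R : ExpAt Clk RelP U} :
      (∀ (V : World) (ρ : V ⟶ U) (κ : Fin V.size), τ.has ρ (A.app V ρ κ) (R.app V ρ κ)) →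
      Conn τ (Tm.kpi A) (kpiRel R)

theorem IsFam.mono {τ υ : PTS U} (h : τ ≤ υ) {A : Tm U 0} {B : Tm U 1} {R : RelAt U}
    {S : ExpAt (Prog 0) RelP U} (hF : IsFam τ A B R S) : IsFam υ A B R S :=
  ⟨PTS.has_of_le h hF.1, fun V ρ M N hR =>
    let ⟨h1, h2, h3, h4⟩ := hF.2 V ρ M N hR
    ⟨PTS.has_of_le h h1, PTS.has_of_le h h2, PTS.has_of_le h h3, PTS.has_of_le h h4⟩⟩

theorem Conn.mono {τ υ : PTS U} (h : τ ≤ υ) {T : Tm U 0} {X : RelAt U} (hc : Conn τ T X) :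
    Conn υ T X := by
  cases hc with
  | void => exact .void
  | unit => exact .unit
  | bool => exact .bool
  | nat => exact .nat
  | sg hF => exact .sg (hF.mono h)
  | pi hF => exact .pi (hF.mono h)
  | wty hF => exact .wty (hF.mono h)
  | eq h1 h2 h3 => exact .eq (PTS.has_of_le h h1) h2 h3
  | later h1 => exact .later (Later.imp (fun _ _ => PTS.has_of_le h) h1)
  | isect h1 => exact .isect (fun V ρ κ => PTS.has_of_le h (h1 V ρ κ))
  | kpi h1 => exact .kpi (fun V ρ κ => PTS.has_of_le h (h1 V ρ κ))

theorem IsFam.res {τ : PTS U} {A : Tm U 0} {B : Tm U 1} {R : RelAt U}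
    {S : ExpAt (Prog 0) RelP U} (hF : IsFam τ A B R S) (ρ : V ⟶ U) :
    IsFam (PowAt.res ρ τ) (A.res ρ) (B.res ρ) (PowAt.res ρ R) (S.res ρ) :=
  ⟨τ.has_res hF.1 ρ, fun W σ M N hR => by
    have := hF.2 W (σ ≫ ρ) M N hR
    rw [← Tm.res_res] at this
    exact this⟩

theorem Conn.res {τ : PTS U} {T : Tm U 0} {X : RelAt U} (hc : Conn τ T X) (ρ : V ⟶ U) :
    Conn (PowAt.res ρ τ) (T.res ρ) (PowAt.res ρ X) := by
  cases hc with
  | void => exact .void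
  | unit => exact .unit
  | bool => exact .bool
  | nat =>
    have : PowAt.res ρ (OrderHom.lfp (natOp U)).valClo = (OrderHom.lfp (natOp V)).valClo :=
      congrArg RelAt.valClo (PowAt.lfp_res ρ (natOp U) (natOp V) (fun _ => rfl))
    rw [this]; exact .nat
  | sg hF => exact .sg (hF.res ρ)
  | pi hF => exact .pi (hF.res ρ)
  | @wty A B R S hF =>
    have : PowAt.res ρ (OrderHom.lfp (wOp R S)).valClo =
        (OrderHom.lfp (wOp (PowAt.res ρ R) (S.res ρ))).valClo :=
      congrArg RelAt.valClo (PowAt.lfp_res ρ (wOp R S) _ (fun _ => rfl))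
    rw [this]; exact .wty (hF.res ρ)
  | @eq A M N R h1 h2 h3 =>
    have e : PowAt.res ρ (eqRel R M N) = eqRel (PowAt.res ρ R) (M.res ρ) (N.res ρ) :=
      RelAt.ext fun W σ M' N' => by
        show (_ ∧ _ ∧ R.rel (σ ≫ ρ) (M.res (σ ≫ ρ)) (N.res (σ ≫ ρ))) ↔
          (_ ∧ _ ∧ R.rel (σ ≫ ρ) ((M.res ρ).res σ) ((N.res ρ).res σ))
        rw [Tm.res_res, Tm.res_res]
    have e' : PowAt.res ρ (eqRel R M N).valClo =
        (eqRel (PowAt.res ρ R) (M.res ρ) (N.res ρ)).valClo := congrArg RelAt.valClo e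
    rw [e']
    exact Conn.eq (τ := PowAt.res ρ τ) (A := A.res ρ) (R := PowAt.res ρ R) (τ.has_res h1 ρ) (R.rel_res h2 ρ) (R.rel_res h3 ρ)
  | @later κ A R h =>
    have e : PowAt.res ρ (laterRel κ R) = laterRel (act ρ κ) (PowAt.res ρ R) :=
      RelAt.ext fun W σ M N => Iff.rfl
    rw [e]
    refine Conn.later (A := A.res ρ) (Later.mono ρ κ (fun W W' α β υ e h => ?_) h)
    have := τ.has_res h υ
    rw [Tm.res_res, PowAt.res_res, e, ← Tm.res_res, ← PowAt.res_res] at this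
    exact this
  | @isect A R h => exact Conn.isect (A := A.res ρ) (R := R.res ρ) fun W σ κ => h W (σ ≫ ρ) κ
  | @kpi A R h => exact Conn.kpi (A := A.res ρ) (R := R.res ρ) fun W σ κ => h W (σ ≫ ρ) κ

/-- The union of the interpretations of all the connectives other than universes. -/
def conns (τ : PTS U) : PTS U :=
  PTS.mk (fun _ ρ T X => Conn (PowAt.res ρ τ) T X) (fun _ _ _ σ _ _ h => h.res σ)

theorem conns_mono {τ υ : PTS U} (h : τ ≤ υ) : conns τ ≤ conns υ :=
  PTS.le_iff.2 fun _ ρ _ _ (hc : Conn _ _ _) => hc.mono (PowAt.res_mono ρ h)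

/-- The monotone operator that extends `ν` and closes under the connectives. -/
def closeOp (ν : PTS U) : PTS U →o PTS U where
  toFun τ := ν ⊔ (conns τ).valClo
  monotone' _ _ h := sup_le_sup_left
    (PTS.valClo_mono (conns_mono h)) ν

/-- The closure of a candidate type system under the connectives. -/
def close (ν : PTS U) : PTS U := OrderHom.lfp (closeOp ν)

theorem close_res (ν : PTS U) (ρ : V ⟶ U) :
    PowAt.res ρ (close ν) = close (PowAt.res ρ ν) :=
  PowAt.lfp_res ρ (closeOp ν) (closeOp (PowAt.res ρ ν)) (fun _ => rfl)

/-! ### The universe hierarchy -/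

/-- `U ⊩ (τ ⊨ A ∼ B type)`. -/
def SimType (τ : PTS U) (A B : Tm U 0) : Prop :=
  ∃ R : RelAt U, τ.has (𝟙 U) A R ∧ τ.has (𝟙 U) B R

/-- `U ⊩ (τ ⊨ M ∼ N ∈ A)`. -/
def SimMem (τ : PTS U) (M N A : Tm U 0) : Prop :=
  ∃ R : RelAt U, τ.has (𝟙 U) A R ∧ R.rel (𝟙 U) M N

/-- The relation of similarity of the types of `τ`. -/
def typeRel (τ : PTS U) : RelAt U :=
  RelAt.mk (fun _ ρ A B => SimType (PowAt.res ρ τ) A B)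
    (fun _ _ _ σ _ _ ⟨R, h1, h2⟩ => ⟨PowAt.res σ R, PTS.has_res _ h1 σ, PTS.has_res _ h2 σ⟩)

/-- The types that evaluate to one of the universes of index `i < n`, where the elements of that
universe are the types of the closure of `ν i`. -/
def univs {n : ℕ} (ν : Fin n → PTS U) : PTS U :=
  PTS.valClo (PTS.mk
    (fun _ ρ T X => ∃ i : Fin n, T = Tm.univ i.1 ∧ X = PowAt.res ρ (typeRel (close (ν i))))
    (by
      rintro V W ρ σ _ _ ⟨i, rfl, rfl⟩
      exact ⟨i, rfl, rfl⟩))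

/-- The spine of the universe hierarchy. -/
def spine (U : World) : ℕ → PTS U
  | 0 => ⊥
  | n + 1 => univs (fun i : Fin (n + 1) => spine U i.1)
  termination_by n => n
  decreasing_by exact i.2

/-- The type system with `n` universes. -/
def tower (U : World) (n : ℕ) : PTS U := close (spine U n)

/-- The join of the type systems `tower U n`. -/
def tsOmega (U : World) : PTS U := ⨆ n, tower U n

theorem univs_res (ρ : V ⟶ U) {n : ℕ} (ν : Fin n → PTS U) :
    PowAt.res ρ (univs ν) = univs (fun i => PowAt.res ρ (ν i)) := by
  have h : ∀ i, typeRel (close (PowAt.res ρ (ν i))) = PowAt.res ρ (typeRel (close (ν i))) :=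
    fun i => by rw [← close_res]; rfl
  simp only [univs, h]
  rfl

theorem spine_res (ρ : V ⟶ U) (n : ℕ) : PowAt.res ρ (spine U n) = spine V n := by
  induction n using Nat.strong_induction_on with
  | _ n ih =>
    cases n with
    | zero => rw [spine, spine]; rfl
    | succ n =>
      rw [spine, spine, univs_res]
      exact congrArg univs (funext fun i => ih i.1 i.2)

theorem tsOmega_has {ρ : V ⟶ U} {A : Tm V 0} {R : RelAt V} :
    (tsOmega U).has ρ A R ↔ ∃ n, (tower U n).has ρ A R := by
  unfold PTS.has PowAt.mem tsOmega
  rw [Subfunctor.iSup_obj]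
  exact Set.mem_iUnion

/-- The family `tsOmega` is a global element of the object of candidate type systems. -/
theorem tsOmega_res (ρ : V ⟶ U) : PowAt.res ρ (tsOmega U) = tsOmega V :=
  PTS.ext fun W σ A R => by
    refine (tsOmega_has (ρ := σ ≫ ρ)).trans (Iff.trans ?_ tsOmega_has.symm)
    refine exists_congr fun n => ?_
    unfold tower
    rw [← spine_res ρ n, ← close_res]
    rfl

end Candidates

/-! ### Sequents -/

/-- Telescopes of length `n`. -/
inductive Tel (U : World) : ℕ → Type
  | nil : Tel U 0
  | snoc {n : ℕ} (Γ : Tel U n) (A : Tm U n) : Tel U (n + 1)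

/-- Restriction of telescopes. -/
def Tel.res {U V : World} (ρ : V ⟶ U) : {n : ℕ} → Tel U n → Tel V n
  | _, .nil => .nil
  | _, .snoc Γ A => .snoc (Γ.res ρ) (A.res ρ)

section Sequents

variable {U : World} {n : ℕ}

/-- Similarity of instantiations of a telescope. The last program of an instantiation has
index `0`. -/
def SimEnv (τ : PTS U) : {n : ℕ} → Tel U n → (γ₀ γ₁ : Fin n → Tm U 0) → Prop
  | _, .nil, _, _ => True
  | _, .snoc Γ A, γ₀, γ₁ => SimEnv τ Γ (Fin.tail γ₀) (Fin.tail γ₁) ∧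
      SimMem τ (γ₀ 0) (γ₁ 0) (A.subst (Fin.tail γ₀))

/-- Open type similarity. -/
def HypSimType (τ : PTS U) (Γ : Tel U n) (A₀ A₁ : Tm U n) : Prop :=
  ∀ (V : World) (ρ : V ⟶ U) (γ₀ γ₁ : Fin n → Tm V 0),
    SimEnv (PowAt.res ρ τ) (Γ.res ρ) γ₀ γ₁ →
    SimType (PowAt.res ρ τ) ((A₀.res ρ).subst γ₀) ((A₁.res ρ).subst γ₁)

/-- Open member similarity. -/
def HypSimMem (τ : PTS U) (Γ : Tel U n) (M₀ M₁ A : Tm U n) : Prop :=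
  ∀ (V : World) (ρ : V ⟶ U) (γ₀ γ₁ : Fin n → Tm V 0),
    SimEnv (PowAt.res ρ τ) (Γ.res ρ) γ₀ γ₁ →
    SimMem (PowAt.res ρ τ) ((M₀.res ρ).subst γ₀) ((M₁.res ρ).subst γ₁) ((A.res ρ).subst γ₀)

/-- Context validity. -/
def IsCtx (τ : PTS U) : {n : ℕ} → Tel U n → Prop
  | _, .nil => True
  | _, .snoc Γ A => IsCtx τ Γ ∧ HypSimType τ Γ A A

end Sequents

/-! ## Formal terms and their elaboration -/

/-- Formal terms with `Δ` free formal clocks and `n` free variables, up to renaming of bound clocks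
and variables (de Bruijn indices for both). -/
inductive FTm : ℕ → ℕ → Type
  | var {Δ n : ℕ} (i : Fin n) : FTm Δ n
  | lam {Δ n : ℕ} (M : FTm Δ (n + 1)) : FTm Δ n
  | klam {Δ n : ℕ} (M : FTm (Δ + 1) n) : FTm Δ n
  | app {Δ n : ℕ} (M N : FTm Δ n) : FTm Δ n
  | kapp {Δ n : ℕ} (M : FTm Δ n) (k : Fin Δ) : FTm Δ n
  | pair {Δ n : ℕ} (M N : FTm Δ n) : FTm Δ n
  | fst {Δ n : ℕ} (M : FTm Δ n) : FTm Δ n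
  | snd {Δ n : ℕ} (M : FTm Δ n) : FTm Δ n
  | fix {Δ n : ℕ} (M : FTm Δ (n + 1)) : FTm Δ n
  | star {Δ n : ℕ} : FTm Δ n
  | tt {Δ n : ℕ} : FTm Δ n
  | ff {Δ n : ℕ} : FTm Δ n
  | ite {Δ n : ℕ} (M N O : FTm Δ n) : FTm Δ n
  | ze {Δ n : ℕ} : FTm Δ n
  | su {Δ n : ℕ} (M : FTm Δ n) : FTm Δ n
  | ifze {Δ n : ℕ} (M N : FTm Δ n) (O : FTm Δ (n + 1)) : FTm Δ n
  | sup {Δ n : ℕ} (M : FTm Δ n) (N : FTm Δ (n + 1)) : FTm Δ n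
  | wrec {Δ n : ℕ} (M : FTm Δ n) (N : FTm Δ (n + 3)) : FTm Δ n
  | pi {Δ n : ℕ} (A : FTm Δ n) (B : FTm Δ (n + 1)) : FTm Δ n
  | sg {Δ n : ℕ} (A : FTm Δ n) (B : FTm Δ (n + 1)) : FTm Δ n
  | wty {Δ n : ℕ} (A : FTm Δ n) (B : FTm Δ (n + 1)) : FTm Δ n
  | eq {Δ n : ℕ} (A M N : FTm Δ n) : FTm Δ n
  | kpi {Δ n : ℕ} (A : FTm (Δ + 1) n) : FTm Δ n
  | isect {Δ n : ℕ} (A : FTm (Δ + 1) n) : FTm Δ n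
  | later {Δ n : ℕ} (k : Fin Δ) (A : FTm Δ n) : FTm Δ n
  | void {Δ n : ℕ} : FTm Δ n
  | unit {Δ n : ℕ} : FTm Δ n
  | bool {Δ n : ℕ} : FTm Δ n
  | nat {Δ n : ℕ} : FTm Δ n
  | univ {Δ n : ℕ} (i : ℕ) : FTm Δ n

namespace FTm

/-- Renaming of formal clocks. -/
def clkRen : {Δ Δ' n : ℕ} → (Fin Δ → Fin Δ') → FTm Δ n → FTm Δ' n
  | _, _, _, _, var i => var i
  | _, _, _, f, lam M => lam (M.clkRen f)
  | _, _, _, f, klam M => klam (M.clkRen (liftRen f))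
  | _, _, _, f, app M N => app (M.clkRen f) (N.clkRen f)
  | _, _, _, f, kapp M k => kapp (M.clkRen f) (f k)
  | _, _, _, f, pair M N => pair (M.clkRen f) (N.clkRen f)
  | _, _, _, f, fst M => fst (M.clkRen f)
  | _, _, _, f, snd M => snd (M.clkRen f)
  | _, _, _, f, fix M => fix (M.clkRen f)
  | _, _, _, _, star => star
  | _, _, _, _, tt => tt
  | _, _, _, _, ff => ff
  | _, _, _, f, ite M N O => ite (M.clkRen f) (N.clkRen f) (O.clkRen f)
  | _, _, _, _, ze => ze
  | _, _, _, f, su M => su (M.clkRen f)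
  | _, _, _, f, ifze M N O => ifze (M.clkRen f) (N.clkRen f) (O.clkRen f)
  | _, _, _, f, sup M N => sup (M.clkRen f) (N.clkRen f)
  | _, _, _, f, wrec M N => wrec (M.clkRen f) (N.clkRen f)
  | _, _, _, f, pi A B => pi (A.clkRen f) (B.clkRen f)
  | _, _, _, f, sg A B => sg (A.clkRen f) (B.clkRen f)
  | _, _, _, f, wty A B => wty (A.clkRen f) (B.clkRen f)
  | _, _, _, f, eq A M N => eq (A.clkRen f) (M.clkRen f) (N.clkRen f)
  | _, _, _, f, kpi A => kpi (A.clkRen (liftRen f))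
  | _, _, _, f, isect A => isect (A.clkRen (liftRen f))
  | _, _, _, f, later k A => later (f k) (A.clkRen f)
  | _, _, _, _, void => void
  | _, _, _, _, unit => unit
  | _, _, _, _, bool => bool
  | _, _, _, _, nat => nat
  | _, _, _, _, univ i => univ i

/-- A term over `Δ`, seen as a term over `Δ, k`, where `k` is a fresh clock (of index `0`). -/
def clkWeaken {Δ n : ℕ} (A : FTm Δ n) : FTm (Δ + 1) n := A.clkRen Fin.succ

/-- Elaboration of formal terms, relative to an assignment of clock names to formal clocks. -/
def elabRaw : {Δ n : ℕ} → FTm Δ n → (U : World) → (Fin Δ → Fin U.size) → Raw U n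
  | _, _, var i, _, _ => .var i
  | _, _, lam M, U, r => .lam (M.elabRaw U r)
  | _, _, klam M, _, r => .klam (fun V ρ κ => M.elabRaw V (Fin.cons κ (fun k => act ρ (r k))))
  | _, _, app M N, U, r => .app (M.elabRaw U r) (N.elabRaw U r)
  | _, _, kapp M k, U, r => .kapp (M.elabRaw U r) (r k)
  | _, _, pair M N, U, r => .pair (M.elabRaw U r) (N.elabRaw U r)
  | _, _, fst M, U, r => .fst (M.elabRaw U r)
  | _, _, snd M, U, r => .snd (M.elabRaw U r)
  | _, _, fix M, U, r => .fix (M.elabRaw U r)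
  | _, _, star, _, _ => .star
  | _, _, tt, _, _ => .tt
  | _, _, ff, _, _ => .ff
  | _, _, ite M N O, U, r => .ite (M.elabRaw U r) (N.elabRaw U r) (O.elabRaw U r)
  | _, _, ze, _, _ => .ze
  | _, _, su M, U, r => .su (M.elabRaw U r)
  | _, _, ifze M N O, U, r => .ifze (M.elabRaw U r) (N.elabRaw U r) (O.elabRaw U r)
  | _, _, sup M N, U, r => .sup (M.elabRaw U r) (N.elabRaw U r)
  | _, _, wrec M N, U, r => .wrec (M.elabRaw U r) (N.elabRaw U r)
  | _, _, pi A B, U, r => .pi (A.elabRaw U r) (B.elabRaw U r)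
  | _, _, sg A B, U, r => .sg (A.elabRaw U r) (B.elabRaw U r)
  | _, _, wty A B, U, r => .wty (A.elabRaw U r) (B.elabRaw U r)
  | _, _, eq A M N, U, r => .eq (A.elabRaw U r) (M.elabRaw U r) (N.elabRaw U r)
  | _, _, kpi A, _, r => .kpi (fun V ρ κ => A.elabRaw V (Fin.cons κ (fun k => act ρ (r k))))
  | _, _, isect A, _, r => .isect (fun V ρ κ => A.elabRaw V (Fin.cons κ (fun k => act ρ (r k))))
  | _, _, later k A, U, r => .later (r k) (A.elabRaw U r)
  | _, _, void, _, _ => .void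
  | _, _, unit, _, _ => .unit
  | _, _, bool, _, _ => .bool
  | _, _, nat, _, _ => .nat
  | _, _, univ i, _, _ => .univ i

theorem act_cons {Δ : ℕ} {V W : World} (σ : W ⟶ V) (κ : Fin V.size) (r : Fin Δ → Fin V.size) :
    (fun k => act σ ((Fin.cons κ r : Fin (Δ + 1) → Fin V.size) k)) =
      Fin.cons (act σ κ) (fun k => act σ (r k)) := by
  funext k
  refine Fin.cases rfl (fun _ => rfl) k

theorem elabRaw_res {Δ n : ℕ} (M : FTm Δ n) {U V : World} (r : Fin Δ → Fin U.size) (ρ : V ⟶ U) :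
    (M.elabRaw U r).res ρ = M.elabRaw V (fun k => act ρ (r k)) := by
  induction M generalizing U V <;> simp_all [elabRaw, Raw.res, act_comp]

theorem elabRaw_natural {Δ n : ℕ} (M : FTm Δ n) {U : World} (r : Fin Δ → Fin U.size) :
    (M.elabRaw U r).Natural := by
  induction M generalizing U with
  | klam M ih | kpi M ih | isect M ih =>
    exact ⟨fun _ _ _ => ih _, fun _ _ _ _ _ => by rw [elabRaw_res, act_cons]; rfl⟩
  | _ => simp_all [elabRaw, Raw.Natural]

/-- Elaboration of formal terms into programs. -/
def elaborate {Δ n : ℕ} (M : FTm Δ n) (U : World) (r : Fin Δ → Fin U.size) : Tm U n :=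
  ⟨M.elabRaw U r, M.elabRaw_natural r⟩

end FTm

/-- Formal typing contexts of length `n` over `Δ` formal clocks. -/
inductive FCtx (Δ : ℕ) : ℕ → Type
  | nil : FCtx Δ 0
  | snoc {n : ℕ} (Γ : FCtx Δ n) (A : FTm Δ n) : FCtx Δ (n + 1)

/-- Elaboration of formal contexts into telescopes. -/
def FCtx.elaborate {Δ : ℕ} (U : World) (r : Fin Δ → Fin U.size) : {n : ℕ} → FCtx Δ n → Tel U n
  | _, .nil => .nil
  | _, .snoc Γ A => .snoc (Γ.elaborate U r) (A.elaborate U r)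

/-- The forcing at `U` of the meaning of the judgment `Δ | Γ ⊢ M₀ = M₁ ∈ A`, i.e. of
`∀ r : Clk ^ Δ. (Γ is a context) ⇒ (Γ ≫ A ∼ A type) ⇒ (Γ ≫ M₀ ∼ M₁ ∈ A)`. -/
def Forces (U : World) {Δ n : ℕ} (Γ : FCtx Δ n) (M₀ M₁ A : FTm Δ n) : Prop :=
  ∀ (V : World) (_ : V ⟶ U) (r : Fin Δ → Fin V.size),
  ∀ (V' : World) (σ : V' ⟶ V), IsCtx (tsOmega V') ((Γ.elaborate V r).res σ) →
  ∀ (V'' : World) (σ' : V'' ⟶ V'),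
    HypSimType (tsOmega V'') ((Γ.elaborate V r).res (σ' ≫ σ))
      ((A.elaborate V r).res (σ' ≫ σ)) ((A.elaborate V r).res (σ' ≫ σ)) →
    HypSimMem (tsOmega V'') ((Γ.elaborate V r).res (σ' ≫ σ))
      ((M₀.elaborate V r).res (σ' ≫ σ)) ((M₁.elaborate V r).res (σ' ≫ σ))
      ((A.elaborate V r).res (σ' ≫ σ))

end ClockCTT

/-!
The rule holds because the object of clocks is inhabited: every world has at least one clock name.
If `A` denotes the relation `R` in a candidate type system closed under the connectives, then the
constant family `κ ↦ A` is assigned the constant family `κ ↦ R`, so `⋂ κ. A` denotes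
`{(M, N) | ∀ κ. (M, N) ∈ R}`. As there is a clock to instantiate the quantifier with, this relation
is `R` itself (`ClockCTT.isectRel_const`), and `A` and `⋂ κ. A` denote the same relation
(`ClockCTT.close_has_isect_const`).

To use this for the elements of `𝒰ᵢ`, three facts are needed. A relation denoted by `𝒰ᵢ` in
`tsOmega` can only be similarity of types in the closure of the `i`-th stage of the spine, because
`𝒰ᵢ` is a value and no other connective interprets it (`ClockCTT.tsOmega_has_univ`); that closure is
closed under clock intersection, since universes are not indexed by clock contexts; and the
elaboration of a weakened type does not depend on the fresh clock, so that after elaboration and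
substitution `⋂ k. A` is literally the intersection of a constant family
(`ClockCTT.elaborate_isect_clkWeaken`, `ClockCTT.Tm.subst_isect_const`).
-/

namespace ClockCTT

/-! ### Constant families over the object of clocks -/

/-- The constant family at a program, as an element of the exponential `Prog n ^ Clk`. -/
def Tm.const {U : World} {n : ℕ} (A : Tm U n) : ExpAt Clk (Prog n) U where
  app _ ρ _ := A.res ρ
  nat _ _ ρ σ _ := A.res_res ρ σ

/-- The constant family at a relation, as an element of the exponential `RelP ^ Clk`. -/
def RelAt.const {U : World} (R : RelAt U) : ExpAt Clk RelP U where
  app _ ρ _ := PowAt.res ρ R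
  nat _ _ ρ σ _ := PowAt.res_res R ρ σ

/-- The intersection of a constant family of relations is its value, because there are clocks. -/
theorem isectRel_const {U : World} (R : RelAt U) : isectRel R.const = R := by
  refine RelAt.ext fun V ρ M N => ⟨fun h => ?_, fun h W σ _ => R.rel_res h σ⟩
  have := h V (𝟙 V) ⟨0, V.pos⟩
  rw [Tm.res_id, Tm.res_id] at this
  exact this

theorem Tm.res_isect_const {U V : World} {n : ℕ} (A : Tm U n) (ρ : V ⟶ U) :
    (Tm.isect A.const).res ρ = Tm.isect (A.res ρ).const := by
  refine Subtype.ext (congrArg Raw.isect ?_)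
  funext W σ _
  exact (A.1.res_res ρ σ).symm

theorem Tm.subst_isect_const {U : World} {m n : ℕ} (A : Tm U m) (γ : Fin m → Tm U n) :
    (Tm.isect A.const).subst γ = Tm.isect (A.subst γ).const := by
  refine Subtype.ext (congrArg Raw.isect ?_)
  funext W σ _
  exact (A.1.res_subst _ σ).symm

/-! ### Closures of candidate type systems -/

theorem close_has {U V : World} {ν : PTS U} {ρ : V ⟶ U} {A : Tm V 0} {R : RelAt V} :
    (close ν).has ρ A R ↔ ν.has ρ A R ∨ (conns (close ν)).valClo.has ρ A R := by
  conv_lhs => rw [close, ← OrderHom.map_lfp]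
  rfl

theorem close_has_isect_const {U : World} {ν : PTS U} {A : Tm U 0} {R : RelAt U}
    (h : (close ν).has (𝟙 U) A R) : (close ν).has (𝟙 U) (Tm.isect A.const) R := by
  refine close_has.2 (Or.inr ⟨_, ⟨.refl, trivial⟩, ?_⟩)
  have hc : Conn (PowAt.res (𝟙 U) (close ν)) (Tm.isect A.const) (isectRel R.const) :=
    .isect fun V ρ _ => PTS.has_res _ h ρ
  rwa [isectRel_const] at hc

/-! ### Inversion for universes -/

theorem Tm.Evals.eq_univ {U : World} {i : ℕ} {T : Tm U 0} (h : (Tm.univ i).Evals T) :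
    T = Tm.univ i := by
  rcases Relation.ReflTransGen.cases_head h.1 with e | ⟨M, hM, _⟩
  · exact e.symm
  · change Raw.Step (Raw.univ i) M.1 at hM
    cases hM

theorem Tm.univ_injective {U : World} {n : ℕ} {i j : ℕ} (h : (Tm.univ i : Tm U n) = Tm.univ j) :
    i = j := by
  have h' : (Raw.univ i : Raw U n) = Raw.univ j := congrArg Subtype.val h
  cases h'
  rfl

theorem not_conn_univ {U : World} {τ : PTS U} {i : ℕ} {X : RelAt U} :
    ¬ Conn τ (Tm.univ i) X := by
  intro h
  generalize hT : Tm.univ i = T at h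
  have hT' : Raw.univ i = T.1 := congrArg Subtype.val hT
  cases h <;> cases hT'

theorem spine_has_univ {U : World} {n i : ℕ} {R : RelAt U}
    (h : (spine U n).has (𝟙 U) (Tm.univ i) R) : R = typeRel (close (spine U i)) := by
  cases n with
  | zero => rw [spine] at h; exact h.elim
  | succ n =>
    rw [spine] at h
    obtain ⟨T, hT, j, rfl, hR⟩ := h
    rw [← Tm.univ_injective hT.eq_univ]
    exact hR.trans (PowAt.res_id _)

/-- The only relation denoted by the universe of index `i` is similarity of the types of the closure
of the `i`-th stage of the spine. -/
theorem tsOmega_has_univ {U : World} {i : ℕ} {R : RelAt U}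
    (h : (tsOmega U).has (𝟙 U) (Tm.univ i) R) : R = typeRel (close (spine U i)) := by
  obtain ⟨n, hn⟩ := tsOmega_has.1 h
  rcases close_has.1 hn with hs | ⟨T, hT, hc⟩
  · exact spine_has_univ hs
  · rw [hT.eq_univ] at hc
    exact (not_conn_univ hc).elim

/-- A program equal to `B` in a universe is also equal to the clock intersection of the constant
family at `B`. -/
theorem SimMem.isect_const {U : World} {A B : Tm U 0} {i : ℕ}
    (h : SimMem (tsOmega U) A B (Tm.univ i)) :
    SimMem (tsOmega U) A (Tm.isect B.const) (Tm.univ i) := by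
  obtain ⟨R, hR, hAB⟩ := h
  refine ⟨R, hR, ?_⟩
  rw [tsOmega_has_univ hR] at hAB ⊢
  obtain ⟨S, hA, hB⟩ := hAB
  exact ⟨S, hA, close_has_isect_const hB⟩

/-! ### Elaboration of weakened terms -/

theorem liftRen_comp_cons {Δ Δ' : ℕ} {X : Type} (f : Fin Δ → Fin Δ') (κ : X) (r : Fin Δ' → X) :
    (fun k => (Fin.cons κ r : Fin (Δ' + 1) → X) (liftRen f k)) =
      Fin.cons κ (fun k => r (f k)) := by
  funext k
  refine Fin.cases rfl (fun _ => rfl) k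

theorem FTm.elabRaw_clkRen {Δ n : ℕ} (M : FTm Δ n) {Δ' : ℕ} (f : Fin Δ → Fin Δ') (U : World)
    (r : Fin Δ' → Fin U.size) :
    (M.clkRen f).elabRaw U r = M.elabRaw U (fun k => r (f k)) := by
  induction M generalizing Δ' U <;> simp_all [FTm.clkRen, FTm.elabRaw, liftRen_comp_cons]

theorem elaborate_isect_clkWeaken {Δ n : ℕ} (A : FTm Δ n) (U : World) (r : Fin Δ → Fin U.size) :
    (FTm.isect A.clkWeaken).elaborate U r = Tm.isect (A.elaborate U r).const := by
  refine Subtype.ext (congrArg Raw.isect ?_)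
  funext V ρ κ
  exact (A.elabRaw_clkRen Fin.succ V _).trans (A.elabRaw_res r ρ).symm

end ClockCTT

theorem mainTheorem4 {Δ n : ℕ} (Γ : ClockCTT.FCtx Δ n) (A : ClockCTT.FTm Δ n) (i : ℕ)
    (U : ClockCTT.World) (hA : ClockCTT.Forces U Γ A A (ClockCTT.FTm.univ i)) :
    ClockCTT.Forces U Γ A (ClockCTT.FTm.isect A.clkWeaken) (ClockCTT.FTm.univ i) := by
  intro V ρ r V' σ hΓ V'' σ' hU W α γ₀ γ₁ hγ
  have h := hA V ρ r V' σ hΓ V'' σ' hU W α γ₀ γ₁ hγ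
  rw [ClockCTT.tsOmega_res] at h ⊢
  rw [ClockCTT.elaborate_isect_clkWeaken, ClockCTT.Tm.res_isect_const,
    ClockCTT.Tm.res_isect_const, ClockCTT.Tm.subst_isect_const]
  exact ClockCTT.SimMem.isect_const h
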